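/- **Theorem (Soundness and Completeness of GŁ$_s$).** Let formulas be built from propositional variables $p_0,p_1,p_2,\dots$ and the constant $\bot$ with the binary connective $\Rightarrow$. A sequent $\Gamma\vdash\Delta$ is an ordered pair of finite (possibly empty) multisets of formulas; commas denote multiset sum. The calculus GŁ$_s$ has the axioms $$(ID)\ \ A\vdash A,\qquad (\Lambda)\ \ \vdash\,,\qquad (\bot)\ \ \bot\vdash A,$$ and the rules - $(W)$: from $\Gamma\vdash\Delta$ infer $\Gamma,A\vdash\Delta$; - $(M)$: from $\Gamma_1\vdash\Delta_1$ and $\Gamma_2\vdash\Delta_2$ infer $\Gamma_1,\Gamma_2\vdash\Delta_1,\Delta_2$; - $(C)$: for any integer $n>0$, from $\underbrace{\Gamma,\dots,\Gamma}_{n}\vdash\underbrace{\Delta,\dots,\Delta}_{n}$ infer $\Gamma\vdash\Delta$; - $(\Rightarrow,l)$: from $\Gamma,B,B\Rightarrow A\vdash\Delta,A$ infer $\Gamma,A\Rightarrow B\vdash\Delta$; - $(\Rightarrow,r)$: from $\Gamma\vdash\Delta$ and $\Gamma,A\vdash\Delta,B$ infer $\Gamma\vdash\Delta,A\Rightarrow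 B$. A sequent *succeeds* in GŁ$_s$ if it can be derived from the axioms by finitely many applications of the rules. Let $[-1,0]_{\textrm{Ł}}$ be the MV-algebra on the real interval $[-1,0]$ with $a\oplus b=\min(0,a+b+1)$, $\sim a=-1-a$, $\bot=-1$, in which $\Rightarrow$ is interpreted by $\sim a\oplus b=\min(0,b-a)$. A valuation is a map $v$ from formulas to $[-1,0]$ with $v(\bot)=-1$ and $v(A\Rightarrow B)=\min(0,v(B)-v(A))$. Write $\models^*_{\textrm{Ł}}\Gamma\vdash\Delta$ if $\sum_{A\in\Gamma}v(A)\le\sum_{B\in\Delta}v(B)$ for all valuations $v$ (real sums, counted with multiplicity, the empty sum being $0$). Then, for every sequent $S$, $$S\text{ succeeds in GŁ}_s\iff\ \models^*_{\textrm{Ł}}S.$$ -/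

import Mathlib

namespace Lukasiewicz

/-- Formulas of Łukasiewicz logic over the propositional variables `p₀, p₁, …`,
with primitive connectives `⊥` and `⇒`. -/
inductive Formula : Type
  | var (i : ℕ) : Formula
  | bot : Formula
  | imp (A B : Formula) : Formula

/-- A sequent `Γ ⊢ Δ`: an ordered pair of finite multisets of formulas. -/
structure Sequent : Type where
  left : Multiset Formula
  right : Multiset Formula

/-- The carrier `[-1, 0]` of the MV-algebra `[-1, 0]_Ł`. -/
abbrev Carrier : Type := Set.Icc (-1 : ℝ) 0

namespace Carrier

/-- The constant `⊥ = -1`. -/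
def bot : Carrier := ⟨-1, by norm_num, by norm_num⟩

/-- The operation `a ⊕ b = min (0, a + b + 1)`. -/
noncomputable def oplus (a b : Carrier) : Carrier :=
  ⟨min 0 ((a : ℝ) + b + 1),
    le_min (by norm_num) (by linarith [a.2.1, b.2.1]), min_le_left _ _⟩

/-- The operation `∼a = -1 - a`. -/
def neg (a : Carrier) : Carrier :=
  ⟨-1 - (a : ℝ), by linarith [a.2.2], by linarith [a.2.1]⟩

/-- The implication `∼a ⊕ b`. -/
noncomputable def imp (a b : Carrier) : Carrier := oplus (neg a) b

theorem coe_imp (a b : Carrier) : (imp a b : ℝ) = min 0 ((b : ℝ) - a) := by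
  change min 0 (-1 - (a : ℝ) + b + 1) = _
  congr 1
  ring

end Carrier

/-- A valuation `v : For → [-1, 0]_Ł`: a map commuting with the connectives. -/
structure Valuation : Type where
  val : Formula → Carrier
  map_bot : val Formula.bot = Carrier.bot
  map_imp : ∀ A B : Formula, val (Formula.imp A B) = Carrier.imp (val A) (val B)

/-- `⊨*_Ł Γ ⊢ Δ`: for every valuation `v` in `[-1, 0]_Ł`, the sum of the values `v A`
over `A ∈ Γ` is at most the sum of the values `v B` over `B ∈ Δ`. The sums are sums of
real numbers over multisets, counted with multiplicity. -/
def Sequent.Valid (S : Sequent) : Prop :=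
  ∀ v : Valuation,
    (S.left.map fun A => (v.val A : ℝ)).sum ≤ (S.right.map fun B => (v.val B : ℝ)).sum

/-- `GLs S` says that the sequent `S` succeeds (has a proof) in the unlabelled single
sequent calculus `GŁ_s`. -/
inductive GLs : Sequent → Prop
  /-- `(ID)`: the axiom `A ⊢ A`. -/
  | id (A : Formula) : GLs ⟨{A}, {A}⟩
  /-- `(Λ)`: the empty sequent as an axiom. -/
  | empty : GLs ⟨0, 0⟩
  /-- `(⊥)`: the axiom `⊥ ⊢ A`. -/
  | bot (A : Formula) : GLs ⟨{Formula.bot}, {A}⟩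
  /-- `(W)`: from `Γ ⊢ Δ` infer `Γ, A ⊢ Δ`. -/
  | weak (Γ Δ : Multiset Formula) (A : Formula) :
      GLs ⟨Γ, Δ⟩ → GLs ⟨Γ + {A}, Δ⟩
  /-- `(M)`: from `Γ₁ ⊢ Δ₁` and `Γ₂ ⊢ Δ₂` infer `Γ₁, Γ₂ ⊢ Δ₁, Δ₂`. -/
  | mix (Γ₁ Γ₂ Δ₁ Δ₂ : Multiset Formula) :
      GLs ⟨Γ₁, Δ₁⟩ → GLs ⟨Γ₂, Δ₂⟩ → GLs ⟨Γ₁ + Γ₂, Δ₁ + Δ₂⟩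
  /-- `(C)`: from `Γ, …, Γ ⊢ Δ, …, Δ` (`n > 0` copies each) infer `Γ ⊢ Δ`. -/
  | contr (n : ℕ) (Γ Δ : Multiset Formula) :
      0 < n → GLs ⟨n • Γ, n • Δ⟩ → GLs ⟨Γ, Δ⟩
  /-- `(⇒, l)`: from `Γ, B, B ⇒ A ⊢ Δ, A` infer `Γ, A ⇒ B ⊢ Δ`. -/
  | impL (Γ Δ : Multiset Formula) (A B : Formula) :
      GLs ⟨Γ + {B} + {Formula.imp B A}, Δ + {A}⟩ → GLs ⟨Γ + {Formula.imp A B}, Δ⟩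
  /-- `(⇒, r)`: from `Γ ⊢ Δ` and `Γ, A ⊢ Δ, B` infer `Γ ⊢ Δ, A ⇒ B`. -/
  | impR (Γ Δ : Multiset Formula) (A B : Formula) :
      GLs ⟨Γ, Δ⟩ → GLs ⟨Γ + {A}, Δ + {B}⟩ → GLs ⟨Γ, Δ + {Formula.imp A B}⟩

end Lukasiewicz

namespace Lukasiewicz

/-!
In every valuation `A ⇒ B` has the value of `B + (B ⇒ A) - A`, so `(⇒, l)` and `(⇒, r)` lose
nothing semantically, and `(⇒, r)` reduces completeness to sequents without implications on the
right. There is no cut, but two applications of `(⇒, l)` to the same formula allow an immediate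
subformula of an implication on the left to be cancelled from both sides. Hence, if `C ⇒ D` is such
a subformula, a sequent is derivable as soon as it is derivable both with `C ⇒ D` and with `D ⇒ C`
added on the left. Given an underivable sequent, a maximal set `H` of formulas that can be added on
the left without making it derivable therefore decides the order of `C` and `D`, which makes the
relations between the values of a component and of its two sides linear. Farkas' lemma, with the
contraction rule for clearing denominators, turns underivability into a real assignment that
satisfies these relations and refutes the sequent; scaled to give `⊥` the value `-1`, it yields a
valuation.
-/

section Farkas

theorem hull_image_add_smul_le {R V ι : Type*} [Semiring R] [PartialOrder R] [IsOrderedRing R]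
    [AddCommMonoid V] [Module R V] {s : Set ι} (a : ι → V) {c : ι → R} (hc : ∀ i ∈ s, 0 ≤ c i)
    (w : V) :
    PointedCone.hull R ((fun i => a i + c i • w) '' s) ≤
      PointedCone.hull R (insert w (a '' s)) := by
  refine Submodule.span_le.2 ?_
  rintro _ ⟨i, hi, rfl⟩
  exact add_mem (PointedCone.subset_hull (Set.mem_insert_of_mem _ (Set.mem_image_of_mem a hi)))
    (PointedCone.smul_mem _ (hc i hi) (PointedCone.subset_hull (Set.mem_insert _ _)))

theorem mem_hull_image_of_forall_nonneg {K V ι : Type*} [Field K] [LinearOrder K]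
    [IsStrictOrderedRing K] [AddCommGroup V] [Module K V] (s : Finset ι)
    (a : ι → Module.Dual K V) (b : Module.Dual K V)
    (h : ∀ x, (∀ i ∈ s, 0 ≤ a i x) → 0 ≤ b x) : b ∈ PointedCone.hull K (a '' s) := by
  classical
  induction s using Finset.induction_on generalizing a b with
  | empty =>
    have hb : b = 0 := by
      ext x
      have hneg := h (-x) (by simp)
      rw [map_neg] at hneg
      exact le_antisymm (neg_nonneg.1 hneg) (h x (by simp))
    exact hb ▸ zero_mem _
  | insert j s _ ih =>
    rw [Finset.coe_insert, Set.image_insert_eq]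
    by_cases hs : ∀ x, (∀ i ∈ s, 0 ≤ a i x) → 0 ≤ b x
    · exact Submodule.span_mono (Set.subset_insert _ _) (ih a b hs)
    push Not at hs
    obtain ⟨z, hz, hbz⟩ := hs
    have hjz : a j z < 0 := by
      by_contra! hjz
      exact hbz.not_ge (h z (Finset.forall_mem_insert _ _ _ |>.2 ⟨hjz, hz⟩))
    -- Project along `z` onto the hyperplane `a j = 0`.
    let proj : Module.Dual K V → Module.Dual K V := fun f => f + (-(f z / a j z)) • a j
    have hproj_apply (f : Module.Dual K V) (x : V) :
        proj f x = f (x - (a j x / a j z) • z) := by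
      simp only [proj, LinearMap.add_apply, LinearMap.smul_apply, map_sub, map_smul, smul_eq_mul]
      ring
    have hproj : proj b ∈ PointedCone.hull K ((fun i => proj (a i)) '' s) := by
      refine ih _ _ fun x hx => ?_
      rw [hproj_apply]
      refine h _ (Finset.forall_mem_insert _ _ _ |>.2 ⟨?_, fun i hi => hproj_apply _ _ ▸ hx i hi⟩)
      simp [hjz.ne]
    have hcoeff : ∀ i ∈ (s : Set ι), 0 ≤ -(a i z / a j z) := fun i hi =>
      neg_nonneg.2 (div_nonpos_of_nonneg_of_nonpos (hz i hi) hjz.le)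
    have hj : a j ∈ PointedCone.hull K (insert (a j) (a '' s)) :=
      PointedCone.subset_hull (Set.mem_insert _ _)
    have hsum : proj b + (b z / a j z) • a j = b := by
      simp only [proj]
      module
    exact hsum ▸ add_mem (hull_image_add_smul_le a hcoeff (a j) hproj)
      (PointedCone.smul_mem _ (div_nonneg_of_nonpos hbz.le hjz.le) hj)

theorem exists_nsmul_mem_closure_of_mem_hull {V : Type*} [AddCommMonoid V] [Module ℚ V]
    {s : Set V} {x : V} (hx : x ∈ PointedCone.hull ℚ s) :
    ∃ n : ℕ, 0 < n ∧ n • x ∈ AddSubmonoid.closure s := by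
  induction hx using Submodule.span_induction with
  | mem x hx => exact ⟨1, one_pos, by simpa using AddSubmonoid.subset_closure hx⟩
  | zero => exact ⟨1, one_pos, by simp⟩
  | add x y _ _ ihx ihy =>
    obtain ⟨m, hm, hx⟩ := ihx
    obtain ⟨n, hn, hy⟩ := ihy
    refine ⟨n * m, mul_pos hn hm, ?_⟩
    rw [nsmul_add, mul_nsmul' x, mul_nsmul y]
    exact add_mem (nsmul_mem hx n) (nsmul_mem hy m)
  | smul r x _ ih =>
    obtain ⟨n, hn, hx⟩ := ih
    obtain ⟨r, hr⟩ := r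
    lift r to ℚ≥0 using hr
    refine ⟨n * r.den, mul_pos hn r.den_pos, ?_⟩
    have hclear : (n * r.den) • ((r : ℚ) • x) = r.num • n • x := by
      simp only [← Nat.cast_smul_eq_nsmul ℚ, smul_smul]
      congr 1
      have hden : (r.den : ℚ) * r = r.num := mod_cast r.den_mul_eq_num
      push_cast
      rw [mul_assoc, hden, mul_comm]
    exact hclear ▸ nsmul_mem hx r.num

theorem exists_mem_closure_map_eq_nsmul {M V : Type*} [AddCommMonoid M] [AddCommGroup V]
    [Module ℚ V] (φ : M →+ Module.Dual ℚ V) {s : Set M} (hs : s.Finite) (m : M)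
    (h : ∀ x, (∀ t ∈ s, 0 ≤ φ t x) → 0 ≤ φ m x) :
    ∃ n : ℕ, 0 < n ∧ ∃ t ∈ AddSubmonoid.closure s, φ t = n • φ m := by
  lift s to Finset M using hs
  obtain ⟨n, hn, hmem⟩ :=
    exists_nsmul_mem_closure_of_mem_hull (mem_hull_image_of_forall_nonneg s φ (φ m) h)
  rw [← AddMonoidHom.map_mclosure] at hmem
  exact ⟨n, hn, hmem⟩

/-- The sum of the values of a function over a multiset, as a linear functional of the function. -/
def sumFunctional (κ : Type*) : Multiset κ →+ Module.Dual ℚ (κ → ℚ) where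
  toFun m :=
    { toFun x := (m.map x).sum
      map_add' x y := Multiset.sum_map_add
      map_smul' r x := Multiset.sum_map_mul_left }
  map_zero' := by ext; simp
  map_add' m m' := by ext; simp

theorem sumFunctional_apply {κ : Type*} (m : Multiset κ) (x : κ → ℚ) :
    sumFunctional κ m x = (m.map x).sum := rfl

theorem sumFunctional_single_one {κ : Type*} [DecidableEq κ] (m : Multiset κ) (a : κ) :
    sumFunctional κ m (Pi.single a 1) = m.count a := by
  rw [sumFunctional_apply]
  induction m using Multiset.induction_on with
  | empty => simp
  | cons b m ih =>
    rw [Multiset.map_cons, Multiset.sum_cons, ih, Multiset.count_cons, Pi.single_apply]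
    push_cast
    simp only [eq_comm (a := a)]
    ring

theorem sumFunctional_injective (κ : Type*) : Function.Injective (sumFunctional κ) := by
  classical
  intro m m' h
  ext a
  have hsingle := LinearMap.congr_fun h (Pi.single a 1)
  rw [sumFunctional_single_one, sumFunctional_single_one] at hsingle
  exact_mod_cast hsingle

/-- The functional `(e, r) ↦ r(b) + e(d) - e(a)` of a triple `(a, b, d)`, which stands for the
sequent `a ⊢ b, d` whose formulas in `b` are evaluated by `r` and all others by `e`. -/
def tripleFunctional (κ : Type*) :
    Multiset κ × Multiset κ × Multiset κ →+ Module.Dual ℚ ((κ → ℚ) × (κ → ℚ)) where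
  toFun t := (sumFunctional κ t.2.2 - sumFunctional κ t.1).coprod (sumFunctional κ t.2.1)
  map_zero' := by ext <;> simp
  map_add' t t' := by
    refine LinearMap.ext fun x => ?_
    simp only [Prod.fst_add, Prod.snd_add, map_add, LinearMap.coprod_apply, LinearMap.sub_apply,
      LinearMap.add_apply]
    ring

theorem tripleFunctional_apply {κ : Type*} (a b d : Multiset κ) (e r : κ → ℚ) :
    tripleFunctional κ (a, b, d) (e, r) =
      sumFunctional κ d e - sumFunctional κ a e + sumFunctional κ b r := rfl

theorem exists_mem_closure_eq_nsmul {κ : Type*}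
    {s : Set (Multiset κ × Multiset κ × Multiset κ)} (hs : s.Finite) (Γ Δ : Multiset κ)
    (h : ∀ e r : κ → ℝ,
      (∀ a b d, (a, b, d) ∈ s → (a.map e).sum ≤ (b.map r).sum + (d.map e).sum) →
        (Γ.map e).sum ≤ (Δ.map r).sum) :
    ∃ n : ℕ, 0 < n ∧ ∃ Z, (n • Γ + Z, n • Δ, Z) ∈ AddSubmonoid.closure s := by
  have hrat : ∀ x, (∀ t ∈ s, 0 ≤ tripleFunctional κ t x) →
      0 ≤ tripleFunctional κ (Γ, Δ, 0) x := by
    rintro ⟨e, r⟩ hx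
    have hcast (y : κ → ℚ) (m : Multiset κ) :
        (m.map fun i => (y i : ℝ)).sum = (sumFunctional κ m y : ℚ) := by
      rw [sumFunctional_apply, Rat.cast_multiset_sum, Multiset.map_map, Function.comp_def]
    have hreal := h (fun i => e i) (fun i => r i) fun a b d ht => by
      have hnonneg := hx _ ht
      rw [tripleFunctional_apply] at hnonneg
      rw [hcast, hcast, hcast]
      norm_cast
      linarith
    rw [hcast, hcast] at hreal
    norm_cast at hreal
    rw [tripleFunctional_apply, map_zero, LinearMap.zero_apply]
    linarith
  obtain ⟨n, hn, ⟨a, b, d⟩, ht, heq⟩ := exists_mem_closure_map_eq_nsmul _ hs _ hrat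
  have happly (e r : κ → ℚ) : sumFunctional κ d e - sumFunctional κ a e + sumFunctional κ b r =
      n * (sumFunctional κ Δ r - sumFunctional κ Γ e) := by
    have := LinearMap.congr_fun heq (e, r)
    rw [LinearMap.smul_apply, tripleFunctional_apply, tripleFunctional_apply, map_zero,
      LinearMap.zero_apply, nsmul_eq_mul] at this
    linarith
  have hb : b = n • Δ := by
    refine sumFunctional_injective κ (LinearMap.ext fun r => ?_)
    simpa using happly 0 r
  have ha : a = n • Γ + d := by
    refine sumFunctional_injective κ (LinearMap.ext fun e => ?_)
    have he := happly e 0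
    simp only [map_zero, map_add, map_nsmul, LinearMap.add_apply, LinearMap.smul_apply,
      nsmul_eq_mul] at he ⊢
    linarith
  exact ⟨n, hn, d, ha ▸ hb ▸ ht⟩

end Farkas

section Semantics

theorem GLs.valid {S : Sequent} (h : GLs S) : S.Valid := by
  intro v
  induction h with
  | id A => exact le_rfl
  | empty => exact le_rfl
  | bot A =>
    simp only [Multiset.map_singleton, Multiset.sum_singleton, v.map_bot]
    exact (v.val A).2.1
  | weak Γ Δ A _ ih =>
    simp only [Multiset.map_add, Multiset.sum_add, Multiset.map_singleton,
      Multiset.sum_singleton] at *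
    linarith [(v.val A).2.2]
  | mix Γ₁ Γ₂ Δ₁ Δ₂ _ _ ih₁ ih₂ =>
    simp only [Multiset.map_add, Multiset.sum_add]
    exact add_le_add ih₁ ih₂
  | contr n Γ Δ hn _ ih =>
    simp only [Multiset.map_nsmul, Multiset.sum_nsmul, nsmul_eq_mul] at ih
    exact le_of_mul_le_mul_left ih (Nat.cast_pos.2 hn)
  | impL Γ Δ A B _ ih =>
    simp only [Multiset.map_add, Multiset.sum_add, Multiset.map_singleton,
      Multiset.sum_singleton, v.map_imp, Carrier.coe_imp] at *
    have hmin : min 0 ((v.val B : ℝ) - v.val A) =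
        v.val B + min 0 ((v.val A : ℝ) - v.val B) - v.val A := by
      rcases le_total (v.val A : ℝ) (v.val B) with hAB | hAB
      · rw [min_eq_left (by linarith), min_eq_right (by linarith)]
        ring
      · rw [min_eq_right (by linarith), min_eq_left (by linarith)]
        ring
    linarith
  | impR Γ Δ A B _ _ ih₁ ih₂ =>
    simp only [Multiset.map_add, Multiset.sum_add, Multiset.map_singleton,
      Multiset.sum_singleton, v.map_imp, Carrier.coe_imp] at *
    rcases min_choice 0 ((v.val B : ℝ) - v.val A) with hmin | hmin <;> linarith

theorem Sequent.Valid.of_impR {Γ Δ : Multiset Formula} {A B : Formula}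
    (h : Sequent.Valid ⟨Γ, Δ + {A.imp B}⟩) :
    Sequent.Valid ⟨Γ, Δ⟩ ∧ Sequent.Valid ⟨Γ + {A}, Δ + {B}⟩ := by
  refine ⟨fun v => ?_, fun v => ?_⟩ <;>
  · have hv := h v
    simp only [Multiset.map_add, Multiset.sum_add, Multiset.map_singleton,
      Multiset.sum_singleton, v.map_imp, Carrier.coe_imp] at *
    have hzero := min_le_left 0 ((v.val B : ℝ) - v.val A)
    have hsub := min_le_right 0 ((v.val B : ℝ) - v.val A)
    linarith

/-- The value of a formula when the variables take the values `g`. -/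
noncomputable def Formula.eval (g : ℕ → Carrier) : Formula → Carrier
  | .var i => g i
  | .bot => Carrier.bot
  | .imp A B => Carrier.imp (A.eval g) (B.eval g)

/-- The valuation in which the variables take the values `g`. -/
noncomputable def Valuation.ofVars (g : ℕ → Carrier) : Valuation where
  val := Formula.eval g
  map_bot := rfl
  map_imp _ _ := rfl

theorem Valuation.exists_forall_mul_var_eq {c : ℝ} (hc : 0 ≤ c) {g : ℕ → ℝ}
    (hg : ∀ i, g i ∈ Set.Icc (-c) 0) : ∃ v : Valuation, ∀ i, c * v.val (.var i) = g i := by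
  have hdiv (i : ℕ) : ∃ t : Carrier, c * t = g i := by
    obtain ⟨hneg, hzero⟩ := hg i
    rcases hc.eq_or_lt with rfl | hc
    · exact ⟨Carrier.bot, by linarith⟩
    · exact ⟨⟨g i / c, (le_div_iff₀ hc).2 (by linarith),
        div_nonpos_of_nonpos_of_nonneg hzero hc.le⟩, mul_div_cancel₀ _ hc.ne'⟩
  choose t ht using hdiv
  exact ⟨.ofVars t, ht⟩

theorem Valuation.mul_bot (v : Valuation) (c : ℝ) : c * v.val .bot = -c := by
  rw [v.map_bot]
  exact mul_neg_one c

theorem Valuation.mul_imp (v : Valuation) {c : ℝ} (hc : 0 ≤ c) (A B : Formula) :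
    c * v.val (A.imp B) = min 0 (c * v.val B - c * v.val A) := by
  rw [v.map_imp, Carrier.coe_imp, mul_min_of_nonneg _ _ hc, mul_zero, mul_sub]

theorem Sequent.Valid.sum_mul_le {Γ Δ : Multiset Formula} (h : Sequent.Valid ⟨Γ, Δ⟩)
    (v : Valuation) {c : ℝ} (hc : 0 ≤ c) :
    (Γ.map fun A => c * v.val A).sum ≤ (Δ.map fun B => c * v.val B).sum := by
  rw [Multiset.sum_map_mul_left, Multiset.sum_map_mul_left]
  exact mul_le_mul_of_nonneg_left (h v) hc

end Semantics

section DerivedRules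

theorem GLs.of_eq {Γ Δ Γ' Δ' : Multiset Formula} (h : GLs ⟨Γ, Δ⟩) (hΓ : Γ = Γ') (hΔ : Δ = Δ') :
    GLs ⟨Γ', Δ'⟩ := hΓ ▸ hΔ ▸ h

theorem GLs.weaken {Γ Δ : Multiset Formula} (h : GLs ⟨Γ, Δ⟩) (Θ : Multiset Formula) :
    GLs ⟨Γ + Θ, Δ⟩ := by
  induction Θ using Multiset.induction_on with
  | empty => simpa using h
  | cons A Θ ih =>
    exact (GLs.weak _ _ A ih).of_eq (by rw [← Multiset.singleton_add]; abel) rfl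

theorem GLs.modusPonens (A B : Formula) : GLs ⟨{A} + {A.imp B}, {B}⟩ := by
  apply GLs.impL
  exact (((GLs.id A).mix _ _ _ _ (GLs.id B)).weak _ _ (B.imp A)).of_eq rfl (add_comm _ _)

theorem GLs.imp_of_converse (A B : Formula) : GLs ⟨{A} + {A.imp B}, {B} + {B.imp A}⟩ := by
  refine GLs.impR _ _ _ _ (GLs.modusPonens A B) ?_
  exact (((GLs.id A).mix _ _ _ _ (GLs.id B)).weaken {A.imp B}).of_eq (by abel) (add_comm _ _)

theorem GLs.cancel_imp {Γ Δ : Multiset Formula} {X Y : Formula}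
    (h : GLs ⟨Γ + {X.imp Y} + {X} + {Y}, Δ + {X} + {Y}⟩) : GLs ⟨Γ + {X.imp Y}, Δ⟩ := by
  apply GLs.impL
  refine GLs.impL (Γ + {Y}) (Δ + {X}) Y X (h.of_eq ?_ ?_) <;> abel

/-- `X.IsComponent F`: the formula `F` is an implication and `X` is one of its two sides. -/
def Formula.IsComponent (X F : Formula) : Prop := ∃ Y, F = X.imp Y ∨ F = Y.imp X

theorem GLs.cancel {Γ Δ : Multiset Formula} {X F : Formula} (hX : X.IsComponent F)
    (h : GLs ⟨Γ + {F} + {X}, Δ + {X}⟩) : GLs ⟨Γ + {F}, Δ⟩ := by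
  obtain ⟨Y, rfl | rfl⟩ := hX
  all_goals refine GLs.cancel_imp ((h.mix _ _ _ _ (GLs.id Y)).of_eq ?_ ?_) <;> abel

/-- `DerivesFrom H Γ Δ`: the sequent `Γ ⊢ Δ` is derivable when each formula of `H` may be added to
its left side arbitrarily often. -/
def DerivesFrom (H : Set Formula) (Γ Δ : Multiset Formula) : Prop :=
  ∃ Θ : Multiset Formula, (∀ A ∈ Θ, A ∈ H) ∧ GLs ⟨Γ + Θ, Δ⟩

/-- The sides of the implications in `Γ` and `H`. These are the formulas that may be cancelled from
both sides of a sequent `Γ ⊢ Δ` derived from `H`. -/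
def components (Γ : Multiset Formula) (H : Set Formula) : Set Formula :=
  {X | ∃ F, (F ∈ Γ ∨ F ∈ H) ∧ X.IsComponent F}

theorem components_mono {Γ Γ' : Multiset Formula} (h : Γ ≤ Γ') (H : Set Formula) :
    components Γ H ⊆ components Γ' H := fun _ ⟨F, hF, hX⟩ =>
  ⟨F, hF.imp_left (Multiset.mem_of_le h), hX⟩

variable {H : Set Formula} {Γ Δ : Multiset Formula}

theorem GLs.derivesFrom (h : GLs ⟨Γ, Δ⟩) : DerivesFrom H Γ Δ := ⟨0, by simp, by simpa using h⟩

theorem GLs.derivesFrom_of_mem {A : Formula} (hA : A ∈ H) (h : GLs ⟨Γ + {A}, Δ⟩) :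
    DerivesFrom H Γ Δ := ⟨{A}, by simpa using hA, h⟩

theorem derivesFrom_empty : DerivesFrom ∅ Γ Δ ↔ GLs ⟨Γ, Δ⟩ := by
  refine ⟨fun ⟨Θ, hΘ, h⟩ => ?_, GLs.derivesFrom⟩
  rwa [Multiset.eq_zero_of_forall_notMem hΘ, add_zero] at h

theorem DerivesFrom.mono {H' : Set Formula} (hH : H ⊆ H') (h : DerivesFrom H Γ Δ) :
    DerivesFrom H' Γ Δ := by
  obtain ⟨Θ, hΘ, h⟩ := h
  exact ⟨Θ, fun A hA => hH (hΘ A hA), h⟩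

theorem DerivesFrom.add {Γ' Δ' : Multiset Formula} (h : DerivesFrom H Γ Δ)
    (h' : DerivesFrom H Γ' Δ') : DerivesFrom H (Γ + Γ') (Δ + Δ') := by
  obtain ⟨Θ, hΘ, h⟩ := h
  obtain ⟨Θ', hΘ', h'⟩ := h'
  refine ⟨Θ + Θ', fun A hA => ?_, (h.mix _ _ _ _ h').of_eq (by abel) rfl⟩
  exact (Multiset.mem_add.1 hA).elim (hΘ A) (hΘ' A)

theorem DerivesFrom.weak (h : DerivesFrom H Γ Δ) (A : Formula) : DerivesFrom H (Γ + {A}) Δ := by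
  obtain ⟨Θ, hΘ, h⟩ := h
  exact ⟨Θ, hΘ, (h.weak _ _ A).of_eq (by abel) rfl⟩

theorem DerivesFrom.contract {n : ℕ} (hn : 0 < n) (h : DerivesFrom H (n • Γ) (n • Δ)) :
    DerivesFrom H Γ Δ := by
  obtain ⟨Θ, hΘ, h⟩ := h
  refine ⟨Θ, hΘ, GLs.contr n _ _ hn ((h.weaken ((n - 1) • Θ)).of_eq ?_ rfl)⟩
  rw [nsmul_add, add_assoc, ← succ_nsmul', Nat.sub_add_cancel hn]

theorem DerivesFrom.cancel {X : Formula} (hX : X ∈ components Γ H)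
    (h : DerivesFrom H (Γ + {X}) (Δ + {X})) : DerivesFrom H Γ Δ := by
  obtain ⟨Θ, hΘ, h⟩ := h
  obtain ⟨F, hF | hF, hX⟩ := hX
  · obtain ⟨Γ, rfl⟩ := Multiset.exists_cons_of_mem hF
    rw [← Multiset.singleton_add] at h ⊢
    refine ⟨Θ, hΘ, (GLs.cancel (Γ := Γ + Θ) hX (h.of_eq ?_ rfl)).of_eq ?_ rfl⟩ <;> abel
  · refine ⟨Θ + {F}, fun A hA => ?_,
      (GLs.cancel (Γ := Γ + Θ) hX ((h.weak _ _ F).of_eq ?_ rfl)).of_eq ?_ rfl⟩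
    · exact (Multiset.mem_add.1 hA).elim (hΘ A) fun hAF => Multiset.mem_singleton.1 hAF ▸ hF
    all_goals abel

theorem DerivesFrom.cancel_multiset {Z : Multiset Formula} (hZ : ∀ X ∈ Z, X ∈ components Γ H)
    (h : DerivesFrom H (Γ + Z) (Δ + Z)) : DerivesFrom H Γ Δ := by
  induction Z using Multiset.induction_on with
  | empty => simpa using h
  | cons X Z ih =>
    refine ih (fun Y hY => hZ Y (Multiset.mem_cons_of_mem hY)) (.cancel (X := X) ?_ ?_)
    · exact components_mono (Multiset.le_add_right _ _) H (hZ X (Multiset.mem_cons_self X Z))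
    · simpa only [← Multiset.singleton_add, add_assoc, add_comm {X} Z] using h

theorem DerivesFrom.split {C D : Formula} (hCD : C.imp D ∈ components Γ H)
    (h₁ : DerivesFrom H (Γ + {C.imp D}) Δ) (h₂ : DerivesFrom H (Γ + {D.imp C}) Δ) :
    DerivesFrom H Γ Δ := by
  obtain ⟨Θ₁, hΘ₁, h₁⟩ := h₁
  obtain ⟨Θ₂, hΘ₂, h₂⟩ := h₂
  refine DerivesFrom.cancel hCD ⟨Θ₁ + Θ₂, fun A hA =>
    (Multiset.mem_add.1 hA).elim (hΘ₁ A) (hΘ₂ A), GLs.impR _ _ _ _ ?_ ?_⟩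
  · exact (h₁.weaken Θ₂).of_eq (by abel) rfl
  · have h₃ : GLs ⟨Γ + Θ₁ + Θ₂ + {C} + {D} + {D.imp C}, Δ + {D} + {C}⟩ :=
      (((h₂.weaken Θ₁).mix _ _ _ _ (GLs.id C)).mix _ _ _ _ (GLs.id D)).of_eq (by abel) (by abel)
    exact (GLs.impL _ _ _ _ h₃).of_eq (by abel) rfl

theorem DerivesFrom.split_nsmul {C D : Formula} (hCD : C.imp D ∈ components Γ H) {m n : ℕ}
    (h₁ : DerivesFrom H (Γ + m • {C.imp D}) Δ) (h₂ : DerivesFrom H (Γ + n • {D.imp C}) Δ) :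
    DerivesFrom H Γ Δ := by
  have hadd {Γ} (hΓ : C.imp D ∈ components Γ H) (A : Formula) :
      C.imp D ∈ components (Γ + {A}) H := components_mono (Multiset.le_add_right _ _) H hΓ
  have hweak {Γ Θ} {A : Formula} (h : DerivesFrom H (Γ + Θ) Δ) :
      DerivesFrom H (Γ + {A} + Θ) Δ := by
    simpa only [add_right_comm] using h.weak A
  induction m generalizing Γ with
  | zero => simpa using h₁
  | succ m ihm =>
    have hfirst : DerivesFrom H (Γ + {C.imp D}) Δ :=
      ihm (hadd hCD _) (by simpa only [succ_nsmul', add_assoc] using h₁) (hweak h₂)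
    clear h₁ ihm
    induction n generalizing Γ with
    | zero => simpa using h₂
    | succ n ihn =>
      refine hfirst.split hCD (ihn (hadd hCD _) ?_ (hweak hfirst))
      simpa only [succ_nsmul', add_assoc] using h₂

end DerivedRules

section MaximalHypotheses

variable {H : Set Formula} {Γ Δ : Multiset Formula}

theorem DerivesFrom.exists_nsmul_of_insert {A : Formula} (h : DerivesFrom (insert A H) Γ Δ) :
    ∃ n : ℕ, DerivesFrom H (Γ + n • {A}) Δ := by
  classical
  obtain ⟨Θ, hΘ, h⟩ := h
  refine ⟨Θ.count A, Θ.filter (· ≠ A), fun B hB => ?_, h.of_eq ?_ rfl⟩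
  · obtain ⟨hB, hBA⟩ := Multiset.mem_filter.1 hB
    exact (hΘ B hB).resolve_left hBA
  · rw [add_assoc, Multiset.nsmul_singleton, ← Multiset.filter_eq', Multiset.filter_add_not]

theorem exists_maximal_not_derivesFrom (h : ¬ GLs ⟨Γ, Δ⟩) :
    ∃ H, Maximal (fun H => ¬ DerivesFrom H Γ Δ) H := by
  have hfin : Order.IsOfFiniteCharacter {H | ¬ DerivesFrom H Γ Δ} := by
    refine fun H => ⟨fun hH K hK _ hder => hH (hder.mono hK), fun hH ⟨Θ, hΘ, hder⟩ => ?_⟩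
    exact hH {A | A ∈ Θ} hΘ Θ.finite_toSet ⟨Θ, fun _ => id, hder⟩
  obtain ⟨H, -, hH⟩ := hfin.exists_maximal (x := ∅) (mt derivesFrom_empty.1 h)
  exact ⟨H, hH⟩

theorem mem_or_mem_of_maximal (hmax : Maximal (fun H => ¬ DerivesFrom H Γ Δ) H) {C D : Formula}
    (hCD : C.imp D ∈ components Γ H) : C.imp D ∈ H ∨ D.imp C ∈ H := by
  have hinsert {A} (hA : A ∉ H) : ∃ n : ℕ, DerivesFrom H (Γ + n • {A}) Δ :=
    (not_not.1 (hmax.not_prop_of_gt (Set.ssubset_insert hA))).exists_nsmul_of_insert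
  by_contra! hnot
  obtain ⟨m, hm⟩ := hinsert hnot.1
  obtain ⟨n, hn⟩ := hinsert hnot.2
  exact hmax.prop (.split_nsmul hCD hm hn)

end MaximalHypotheses

section LinearAssignments

/-- A set of formulas containing both sides of each of its implications. -/
def SubformulaClosed (T : Set Formula) : Prop :=
  ∀ {C D : Formula}, C.imp D ∈ T → C ∈ T ∧ D ∈ T

/-- The set of all subformulas of a formula, including the formula itself. -/
def Formula.subformulas : Formula → Set Formula
  | .var i => {.var i}
  | .bot => {.bot}
  | .imp A B => insert (A.imp B) (A.subformulas ∪ B.subformulas)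

theorem Formula.self_mem_subformulas (F : Formula) : F ∈ F.subformulas := by
  cases F <;> simp [Formula.subformulas]

theorem Formula.finite_subformulas (F : Formula) : F.subformulas.Finite := by
  induction F with
  | var i => exact Set.finite_singleton _
  | bot => exact Set.finite_singleton _
  | imp A B ihA ihB => exact (ihA.union ihB).insert _

theorem Formula.subformulaClosed_subformulas (F : Formula) : SubformulaClosed F.subformulas := by
  intro C D h
  induction F with
  | var i => simp [Formula.subformulas] at h
  | bot => simp [Formula.subformulas] at h
  | imp A B ihA ihB =>
    rcases h with h | h | h
    · obtain ⟨rfl, rfl⟩ := Formula.imp.inj h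
      exact ⟨.inr (.inl C.self_mem_subformulas), .inr (.inr D.self_mem_subformulas)⟩
    · exact (ihA h).imp (.inr ∘ .inl) (.inr ∘ .inl)
    · exact (ihB h).imp (.inr ∘ .inr) (.inr ∘ .inr)

theorem exists_finite_subformulaClosed {s : Set Formula} (hs : s.Finite) :
    ∃ T : Set Formula, T.Finite ∧ s ⊆ T ∧ SubformulaClosed T := by
  refine ⟨⋃ F ∈ s, F.subformulas, hs.biUnion fun F _ => F.finite_subformulas,
    fun F hF => Set.mem_biUnion hF F.self_mem_subformulas, fun {C D} h => ?_⟩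
  simp only [Set.mem_iUnion₂] at h ⊢
  obtain ⟨F, hF, h⟩ := h
  obtain ⟨hC, hD⟩ := F.subformulaClosed_subformulas h
  exact ⟨⟨F, hF, hC⟩, F, hF, hD⟩

/-- The multisets of at most two elements of `T`. -/
def smallMultisets {α : Type*} (T : Set α) : Set (Multiset α) :=
  {m | (∀ a ∈ m, a ∈ T) ∧ m.card ≤ 2}

theorem finite_smallMultisets {α : Type*} {T : Set α} (hT : T.Finite) :
    (smallMultisets T).Finite := by
  classical
  refine (Set.finite_Iic (2 • hT.toFinset.val)).subset fun m ⟨hm, hcard⟩ => ?_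
  refine Multiset.le_iff_count.2 fun a => ?_
  by_cases ha : a ∈ m
  · have haT : a ∈ hT.toFinset := hT.mem_toFinset.2 (hm a ha)
    rw [Multiset.count_nsmul, Multiset.count_eq_one_of_mem hT.toFinset.nodup haT]
    exact (Multiset.count_le_card a m).trans hcard
  · simp [Multiset.count_eq_zero.2 ha]

theorem zero_mem_smallMultisets {α : Type*} (T : Set α) : 0 ∈ smallMultisets T := by
  simp [smallMultisets]

theorem singleton_mem_smallMultisets {α : Type*} {T : Set α} {a : α} (ha : a ∈ T) :
    {a} ∈ smallMultisets T := by
  simpa [smallMultisets] using ha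

theorem pair_mem_smallMultisets {α : Type*} {T : Set α} {a b : α} (ha : a ∈ T) (hb : b ∈ T) :
    {a} + {b} ∈ smallMultisets T := by
  simp [smallMultisets, ha, hb]

/-- The triples `(a, b, d)` such that the sequent `a ⊢ b, d` is derivable from `H` and all formulas
in `d` may be cancelled from a sequent with left side `Γ`. -/
def derivableTriples (Γ : Multiset Formula) (H : Set Formula) :
    AddSubmonoid (Multiset Formula × Multiset Formula × Multiset Formula) where
  carrier := {t | (∀ X ∈ t.2.2, X ∈ components Γ H) ∧ DerivesFrom H t.1 (t.2.1 + t.2.2)}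
  zero_mem' := ⟨by simp, GLs.empty.derivesFrom⟩
  add_mem' {s t} hs ht := ⟨fun X hX => (Multiset.mem_add.1 hX).elim (hs.1 X) (ht.1 X), by
    simpa only [Prod.fst_add, Prod.snd_add, add_add_add_comm] using hs.2.add ht.2⟩

/-- The linear inequalities imposed on the values of the formulas in `T` by the derivable sequents
`a ⊢ b, d` with at most two formulas in each part. The formulas in `b` are evaluated by `R`, all
others by `E`: only components can be cancelled, so an occurrence on the right of the sequent to be
derived need not have the value of the same formula elsewhere. -/
def RespectsDerivable (Γ : Multiset Formula) (H T : Set Formula) (E R : Formula → ℝ) : Prop :=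
  ∀ {a b d : Multiset Formula}, a ∈ smallMultisets T → b ∈ smallMultisets T →
    d ∈ smallMultisets T → (∀ X ∈ d, X ∈ components Γ H) → DerivesFrom H a (b + d) →
      (a.map E).sum ≤ (b.map R).sum + (d.map E).sum

theorem exists_respectsDerivable_of_not_derivesFrom {H T : Set Formula} {Γ Δ : Multiset Formula}
    (hT : T.Finite) (h : ¬ DerivesFrom H Γ Δ) :
    ∃ E R, RespectsDerivable Γ H T E R ∧ (Δ.map R).sum < (Γ.map E).sum := by
  let s := (smallMultisets T ×ˢ smallMultisets T ×ˢ smallMultisets T) ∩ derivableTriples Γ H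
  have hfin := finite_smallMultisets hT
  have hs : s.Finite := (hfin.prod (hfin.prod hfin)).subset Set.inter_subset_left
  contrapose! h
  obtain ⟨n, hn, Z, hZ⟩ := exists_mem_closure_eq_nsmul hs Γ Δ fun E R hER =>
    h E R fun ha hb hd hcomp hder => hER _ _ _ ⟨⟨ha, hb, hd⟩, hcomp, hder⟩
  have hclosure : AddSubmonoid.closure s ≤ derivableTriples Γ H :=
    AddSubmonoid.closure_le.2 Set.inter_subset_right
  obtain ⟨hcomp, hder⟩ := hclosure hZ
  have hΓ : Γ ≤ n • Γ := by simpa using nsmul_le_nsmul_left (Multiset.zero_le Γ) hn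
  exact (hder.cancel_multiset fun X hX => components_mono hΓ H (hcomp X hX)).contract hn

namespace RespectsDerivable

variable {Γ : Multiset Formula} {H T : Set Formula} {E R : Formula → ℝ} {F G C D : Formula}

theorem le_zero (hER : RespectsDerivable Γ H T E R) (hF : F ∈ T) : E F ≤ 0 := by
  simpa using hER (singleton_mem_smallMultisets hF) (zero_mem_smallMultisets T)
    (zero_mem_smallMultisets T) (by simp) (GLs.weak _ _ F GLs.empty).derivesFrom

theorem le_right_of_gls (hER : RespectsDerivable Γ H T E R) (hF : F ∈ T) (hG : G ∈ T)
    (h : GLs ⟨{F}, {G}⟩) : E F ≤ R G := by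
  simpa using hER (singleton_mem_smallMultisets hF) (singleton_mem_smallMultisets hG)
    (zero_mem_smallMultisets T) (by simp) (by simpa using h.derivesFrom)

theorem le_of_gls (hER : RespectsDerivable Γ H T E R) (hF : F ∈ T) (hG : G ∈ T)
    (hcomp : G ∈ components Γ H) (h : GLs ⟨{F}, {G}⟩) : E F ≤ E G := by
  simpa using hER (singleton_mem_smallMultisets hF) (zero_mem_smallMultisets T)
    (singleton_mem_smallMultisets hG) (by simpa using hcomp) (by simpa using h.derivesFrom)

theorem add_imp_le (hER : RespectsDerivable Γ H T E R) (hT : SubformulaClosed T)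
    (hCD : C.imp D ∈ T) (hD : D ∈ components Γ H) : E C + E (C.imp D) ≤ E D := by
  simpa using hER (pair_mem_smallMultisets (hT hCD).1 hCD) (zero_mem_smallMultisets T)
    (singleton_mem_smallMultisets (hT hCD).2) (by simpa using hD)
    (by simpa using (GLs.modusPonens C D).derivesFrom)

theorem imp_nonneg (hER : RespectsDerivable Γ H T E R) (hCD : C.imp D ∈ T)
    (hcomp : C.imp D ∈ components Γ H) (hmem : C.imp D ∈ H) : 0 ≤ E (C.imp D) := by
  simpa using hER (zero_mem_smallMultisets T) (zero_mem_smallMultisets T)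
    (singleton_mem_smallMultisets hCD) (by simpa using hcomp)
    (GLs.derivesFrom_of_mem hmem (by simpa using GLs.id (C.imp D)))

theorem le_add_imp (hER : RespectsDerivable Γ H T E R) (hT : SubformulaClosed T)
    (hCD : C.imp D ∈ T) (hC : C ∈ components Γ H) (hcomp : C.imp D ∈ components Γ H)
    (hmem : D.imp C ∈ H) : E D ≤ E C + E (C.imp D) := by
  simpa using hER (singleton_mem_smallMultisets (hT hCD).2) (zero_mem_smallMultisets T)
    (pair_mem_smallMultisets (hT hCD).1 hCD) (by simp [hC, hcomp])
    (GLs.derivesFrom_of_mem hmem (by simpa using GLs.imp_of_converse D C))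

theorem imp_eq_min (hER : RespectsDerivable Γ H T E R) (hT : SubformulaClosed T)
    (hCD : C.imp D ∈ T) (hC : C ∈ components Γ H) (hD : D ∈ components Γ H)
    (hcomp : C.imp D ∈ components Γ H) (hdec : C.imp D ∈ H ∨ D.imp C ∈ H) :
    E (C.imp D) = min 0 (E D - E C) := by
  refine le_antisymm (le_min (hER.le_zero hCD) ?_) ?_
  · linarith [hER.add_imp_le hT hCD hD]
  · rcases hdec with hmem | hmem
    · exact (min_le_left _ _).trans (hER.imp_nonneg hCD hcomp hmem)
    · exact (min_le_right _ _).trans (by linarith [hER.le_add_imp hT hCD hC hcomp hmem])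

end RespectsDerivable

end LinearAssignments

section Completeness

/-- `v.Realizes E`: up to scaling the value of `⊥` to `-1`, the valuation `v` agrees with `E` on the
variables, the values given by `E` being truncated to the interval from `E ⊥` to `0`. -/
def Valuation.Realizes (v : Valuation) (E : Formula → ℝ) : Prop :=
  ∀ i, -E .bot * v.val (.var i) = min 0 (max (E .bot) (E (.var i)))

theorem Valuation.exists_realizes {E : Formula → ℝ} (h : E .bot ≤ 0) :
    ∃ v : Valuation, v.Realizes E :=
  Valuation.exists_forall_mul_var_eq (neg_nonneg.2 h) fun _ =>
    ⟨by rw [neg_neg]; exact le_min h (le_max_left _ _), min_le_left _ _⟩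

variable {Γ Δ : Multiset Formula} {H T : Set Formula} {E R : Formula → ℝ} {v : Valuation}
  {F : Formula}

theorem RespectsDerivable.mul_val_eq_of_mem_components (hER : RespectsDerivable Γ H T E R)
    (hT : SubformulaClosed T) (hbot : .bot ∈ T)
    (hdec : ∀ {C D : Formula}, C.imp D ∈ components Γ H → C.imp D ∈ H ∨ D.imp C ∈ H)
    (hv : v.Realizes E) (hF : F ∈ T) (hcomp : F ∈ components Γ H) :
    -E .bot * v.val F = E F := by
  induction F with
  | var i =>
    rw [hv i, max_eq_right (hER.le_of_gls hbot hF hcomp (GLs.bot _)),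
      min_eq_right (hER.le_zero hF)]
  | bot => rw [v.mul_bot, neg_neg]
  | imp C D ihC ihD =>
    have hCD := hdec hcomp
    have hC : C ∈ components Γ H :=
      hCD.elim (⟨_, .inr ·, D, .inl rfl⟩) (⟨_, .inr ·, D, .inr rfl⟩)
    have hD : D ∈ components Γ H :=
      hCD.elim (⟨_, .inr ·, C, .inr rfl⟩) (⟨_, .inr ·, C, .inl rfl⟩)
    rw [v.mul_imp (neg_nonneg.2 (hER.le_zero hbot)), ihC (hT hF).1 hC, ihD (hT hF).2 hD,
      hER.imp_eq_min hT hF hC hD hcomp hCD]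

theorem RespectsDerivable.le_mul_val_of_mem_left (hER : RespectsDerivable Γ H T E R)
    (hT : SubformulaClosed T) (hbot : .bot ∈ T)
    (hdec : ∀ {C D : Formula}, C.imp D ∈ components Γ H → C.imp D ∈ H ∨ D.imp C ∈ H)
    (hv : v.Realizes E) (hF : F ∈ T) (hΓ : F ∈ Γ) : E F ≤ -E .bot * v.val F := by
  cases F with
  | var i =>
    rw [hv i]
    exact le_min (hER.le_zero hF) (le_max_right _ _)
  | bot => rw [v.mul_bot, neg_neg]
  | imp C D =>
    have hC : C ∈ components Γ H := ⟨_, .inl hΓ, D, .inl rfl⟩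
    have hD : D ∈ components Γ H := ⟨_, .inl hΓ, C, .inr rfl⟩
    rw [v.mul_imp (neg_nonneg.2 (hER.le_zero hbot)),
      hER.mul_val_eq_of_mem_components hT hbot hdec hv (hT hF).1 hC,
      hER.mul_val_eq_of_mem_components hT hbot hdec hv (hT hF).2 hD]
    exact le_min (hER.le_zero hF) (by linarith [hER.add_imp_le hT hF hD])

theorem RespectsDerivable.mul_val_le_right (hER : RespectsDerivable Γ H T E R) (hbot : .bot ∈ T)
    (hv : v.Realizes E) (hF : F ∈ T) (hatom : ∀ A B : Formula, F ≠ A.imp B) :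
    -E .bot * v.val F ≤ R F := by
  cases F with
  | var i =>
    rw [hv i]
    exact (min_le_right _ _).trans
      (max_le (hER.le_right_of_gls hbot hF (GLs.bot _)) (hER.le_right_of_gls hF hF (GLs.id _)))
  | bot =>
    rw [v.mul_bot, neg_neg]
    exact hER.le_right_of_gls hbot hbot (GLs.id _)
  | imp A B => exact absurd rfl (hatom A B)

theorem GLs.of_valid_of_atomic (hatom : ∀ A B, Formula.imp A B ∉ Δ)
    (hvalid : Sequent.Valid ⟨Γ, Δ⟩) : GLs ⟨Γ, Δ⟩ := by
  by_contra hnot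
  obtain ⟨H, hmax⟩ := exists_maximal_not_derivesFrom hnot
  obtain ⟨T, hfin, hsub, hT⟩ :=
    exists_finite_subformulaClosed (({.bot} + Γ + Δ : Multiset Formula).finite_toSet)
  have hmem {F} (hF : F ∈ ({.bot} + Γ + Δ : Multiset Formula)) : F ∈ T := hsub hF
  have hbot : .bot ∈ T := hmem (by simp)
  obtain ⟨E, R, hER, hlt⟩ := exists_respectsDerivable_of_not_derivesFrom hfin hmax.prop
  obtain ⟨v, hv⟩ := Valuation.exists_realizes (hER.le_zero hbot)
  refine hlt.not_ge ?_
  calc (Γ.map E).sum ≤ (Γ.map fun F => -E .bot * v.val F).sum :=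
        Multiset.sum_map_le_sum_map _ _ fun F hF =>
          hER.le_mul_val_of_mem_left hT hbot (mem_or_mem_of_maximal hmax) hv
            (hmem (by simp [hF])) hF
    _ ≤ (Δ.map fun F => -E .bot * v.val F).sum :=
        hvalid.sum_mul_le v (neg_nonneg.2 (hER.le_zero hbot))
    _ ≤ (Δ.map R).sum :=
        Multiset.sum_map_le_sum_map _ _ fun F hF =>
          hER.mul_val_le_right hbot hv (hmem (by simp [hF])) fun A B h => hatom A B (h ▸ hF)

theorem GLs.of_valid (hvalid : Sequent.Valid ⟨Γ, Δ⟩) : GLs ⟨Γ, Δ⟩ := by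
  induction hsize : (Δ.map sizeOf).sum using Nat.strong_induction_on generalizing Γ Δ with
  | _ n ih =>
    by_cases hatom : ∀ A B, Formula.imp A B ∉ Δ
    · exact GLs.of_valid_of_atomic hatom hvalid
    push Not at hatom
    obtain ⟨A, B, hAB⟩ := hatom
    obtain ⟨Δ, rfl⟩ := Multiset.exists_cons_of_mem hAB
    rw [← Multiset.singleton_add, add_comm] at hvalid hsize ⊢
    simp only [Multiset.map_add, Multiset.sum_add, Multiset.map_singleton,
      Multiset.sum_singleton, Formula.imp.sizeOf_spec] at hsize
    refine GLs.impR _ _ _ _ (ih _ ?_ hvalid.of_impR.1 rfl) (ih _ ?_ hvalid.of_impR.2 rfl)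
    · omega
    · simp only [Multiset.map_add, Multiset.sum_add, Multiset.map_singleton,
        Multiset.sum_singleton]
      omega

end Completeness

end Lukasiewicz

theorem mainTheorem12 (S : Lukasiewicz.Sequent) :
    Lukasiewicz.GLs S ↔ S.Valid :=
  ⟨Lukasiewicz.GLs.valid, Lukasiewicz.GLs.of_valid⟩
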